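/- **Theorem 2.2 (orthogonality).** For a complex $2\times 2$ matrix $g=\begin{pmatrix} g_{1,1}&g_{1,2}\\ g_{2,1}&g_{2,2}\end{pmatrix}$ define the deformed complex Hermite polynomials $H^{(g)}_{m,n}(z_1,z_2)$, $m,n\ge 0$, by the generating function $$\sum_{m,n=0}^\infty \frac{u^m v^n}{m!\,n!}H^{(g)}_{m,n}(z_1,z_2)=\exp\big((g_{1,1}u+g_{1,2}v)z_1+(g_{2,1}u+g_{2,2}v)z_2-(g_{1,1}u+g_{1,2}v)(g_{2,1}u+g_{2,2}v)\big).$$ Let $g,h$ be complex $2\times2$ matrices, let $h^*$ be the conjugate transpose of $h$, and write $z=x+iy$. All the integrals below converge absolutely. The relation $$\int_{\mathbb R^2}H^{(g)}_{m,n}(z,\bar z)\,\overline{H^{(h)}_{p,q}(z,\bar z)}\,e^{-x^2-y^2}\,dx\,dy=0$$ holds for all $m,n,p,q\ge 0$ with $(m,n)\ne(p,q)$ if and only if there are $\lambda_1,\lambda_2\in\mathbb C$ with $$h^*g=\begin{pmatrix}\lambda_1&0\\0&\lambda_2\end{pmatrix}.$$ In that case, for all $m,n,p,q\ge0$, $$\int_{\mathbb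 R^2}H^{(g)}_{m,n}(z,\bar z)\,\overline{H^{(h)}_{p,q}(z,\bar z)}\,e^{-x^2-y^2}\,dx\,dy=\pi\,m!\,n!\,\lambda_1^m\lambda_2^n\,\delta_{m,p}\,\delta_{n,q},$$ where $0^0=1$. -/

import Mathlib

/-- The function of `(u, v)` whose Taylor expansion at the origin defines the deformed complex
Hermite polynomials:
`exp((g₁₁u + g₁₂v) z₁ + (g₂₁u + g₂₂v) z₂ - (g₁₁u + g₁₂v)(g₂₁u + g₂₂v))`. -/
noncomputable def deformedGenFun (g : Matrix (Fin 2) (Fin 2) ℂ) (z₁ z₂ u v : ℂ) : ℂ :=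
  Complex.exp ((g 0 0 * u + g 0 1 * v) * z₁ + (g 1 0 * u + g 1 1 * v) * z₂
    - (g 0 0 * u + g 0 1 * v) * (g 1 0 * u + g 1 1 * v))

/-- The deformed complex Hermite polynomial `H^{(g)}_{m,n}(z₁, z₂)`: the coefficient of
`u^m v^n / (m! n!)` in the Taylor expansion at `(0, 0)` of the entire function
`deformedGenFun g z₁ z₂`, that is, its mixed partial derivative `∂_u^m ∂_v^n` at `(0, 0)`. -/
noncomputable def deformedHermite (g : Matrix (Fin 2) (Fin 2) ℂ) (m n : ℕ) (z₁ z₂ : ℂ) : ℂ :=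
  iteratedDeriv m (fun u : ℂ => iteratedDeriv n (fun v : ℂ => deformedGenFun g z₁ z₂ u v) 0) 0

/-- The integrand `H^{(g)}_{m,n}(z, z̄) * conj (H^{(h)}_{p,q}(z, z̄)) * e^{-x²-y²}` at
`w = (x, y) ∈ ℝ²`, where `z = x + i y`. -/
noncomputable def hermiteIntegrand (g h : Matrix (Fin 2) (Fin 2) ℂ) (m n p q : ℕ) (w : ℝ × ℝ) :
    ℂ :=
  deformedHermite g m n (w.1 + w.2 * Complex.I) (w.1 - w.2 * Complex.I) *
    (starRingEnd ℂ) (deformedHermite h p q (w.1 + w.2 * Complex.I) (w.1 - w.2 * Complex.I)) *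
    (Real.exp (-w.1 ^ 2 - w.2 ^ 2) : ℂ)

open MvPolynomial MeasureTheory

/-! Each derivative of the generating function in `u` or `v` acts on a polynomial prefactor as a
first-order operator `raise`, so the deformed polynomials arise from `1` by iterated raising
(`deformedHermite_eq_eval`). The Gaussian satisfies the integration by parts `X₀ ↔ ∂₁`, `X₁ ↔ ∂₀`,
which makes the adjoint of `raise` a derivation (`gaussianFunctional_raise_mul`). Derivations lower
the indices, and conjugation turns the second factor into another such polynomial. Moving one
raising operator across the pairing therefore gives a recurrence whose coefficients are the entries
of `h* g`. If `h* g` is diagonal, the recurrence yields the formula by induction; conversely, the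
pairings of degree-one polynomials are `π` times the entries of `h* g`. -/

/-- The raising operator `a (X₀ - ∂₁) + b (X₁ - ∂₀)` on polynomials in two variables. -/
noncomputable def raise (a b : ℂ) (P : MvPolynomial (Fin 2) ℂ) : MvPolynomial (Fin 2) ℂ :=
  C a * (X 0 * P - pderiv 1 P) + C b * (X 1 * P - pderiv 0 P)

/-- The deformed complex Hermite polynomial obtained from `1` by raising operators. -/
noncomputable def hermitePoly (g : Matrix (Fin 2) (Fin 2) ℂ) (m n : ℕ) : MvPolynomial (Fin 2) ℂ :=
  (raise (g 0 0) (g 1 0))^[m] ((raise (g 0 1) (g 1 1))^[n] 1)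

/-! ### Algebra of raising operators -/

theorem pderiv_zero_pderiv_one (P : MvPolynomial (Fin 2) ℂ) :
    pderiv 0 (pderiv 1 P) = pderiv 1 (pderiv 0 P) := by
  induction P using MvPolynomial.induction_on with
  | C a => simp
  | add p q hp hq => simp [hp, hq]
  | mul_X p i hp =>
    fin_cases i <;> simp [pderiv_X, hp] <;> ring

/-- Partial derivatives commute with each other, so the commutator comes only from `[∂₀, X₀] = 1`.
-/
theorem pderiv_zero_raise (a b : ℂ) (P : MvPolynomial (Fin 2) ℂ) :
    pderiv 0 (raise a b P) = raise a b (pderiv 0 P) + C a * P := by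
  simp [raise, pderiv_X, pderiv_zero_pderiv_one P]
  ring

theorem pderiv_one_raise (a b : ℂ) (P : MvPolynomial (Fin 2) ℂ) :
    pderiv 1 (raise a b P) = raise a b (pderiv 1 P) + C b * P := by
  simp [raise, pderiv_X, pderiv_zero_pderiv_one P]
  ring

theorem raise_add (a b : ℂ) (P Q : MvPolynomial (Fin 2) ℂ) :
    raise a b (P + Q) = raise a b P + raise a b Q := by
  simp [raise]; ring

theorem raise_C_mul (a b c : ℂ) (P : MvPolynomial (Fin 2) ℂ) :
    raise a b (C c * P) = C c * raise a b P := by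
  simp only [raise, pderiv_C_mul]; ring

theorem hermitePoly_zero_zero (g : Matrix (Fin 2) (Fin 2) ℂ) : hermitePoly g 0 0 = 1 := rfl

theorem hermitePoly_succ_left (g : Matrix (Fin 2) (Fin 2) ℂ) (m n : ℕ) :
    hermitePoly g (m + 1) n = raise (g 0 0) (g 1 0) (hermitePoly g m n) := by
  simp only [hermitePoly, Function.iterate_succ_apply']

theorem hermitePoly_zero_succ (g : Matrix (Fin 2) (Fin 2) ℂ) (n : ℕ) :
    hermitePoly g 0 (n + 1) = raise (g 0 1) (g 1 1) (hermitePoly g 0 n) := by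
  simp only [hermitePoly, Function.iterate_succ_apply', Function.iterate_zero, id]

/-- The partial derivatives act on deformed Hermite polynomials by lowering the indices. -/
theorem pderiv_hermitePoly (g : Matrix (Fin 2) (Fin 2) ℂ) (i : Fin 2) (m n : ℕ) :
    pderiv i (hermitePoly g m n) =
      C (g i 0 * m) * hermitePoly g (m - 1) n + C (g i 1 * n) * hermitePoly g m (n - 1) := by
  have key : ∀ (a : Fin 2 → ℂ) (P : MvPolynomial (Fin 2) ℂ), pderiv i (raise (a 0) (a 1) P) =
      raise (a 0) (a 1) (pderiv i P) + C (a i) * P := by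
    intro a P
    fin_cases i
    · exact pderiv_zero_raise _ _ P
    · exact pderiv_one_raise _ _ P
  induction m with
  | zero =>
    induction n with
    | zero => simp [hermitePoly_zero_zero]
    | succ n ih =>
      rw [hermitePoly_zero_succ, key (fun j => g j 1), ih, raise_add, raise_C_mul, raise_C_mul]
      cases n with
      | zero => simp
      | succ n =>
        rw [Nat.add_sub_cancel, Nat.add_sub_cancel, hermitePoly_zero_succ]
        simp
        ring
  | succ m ih =>
    rw [hermitePoly_succ_left, key (fun j => g j 0), ih, raise_add, raise_C_mul, raise_C_mul]
    rw [Nat.add_sub_cancel, ← hermitePoly_succ_left, ← hermitePoly_succ_left]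
    cases m with
    | zero => simp; ring
    | succ m =>
      rw [Nat.add_sub_cancel]
      simp
      ring

/-! ### The generating function -/

/-- Chain rule for a polynomial in two variables along a curve. -/
theorem hasDerivAt_eval (P : MvPolynomial (Fin 2) ℂ) {x y : ℂ → ℂ} {x' y' t : ℂ}
    (hx : HasDerivAt x x' t) (hy : HasDerivAt y y' t) :
    HasDerivAt (fun s => eval ![x s, y s] P)
      (x' * eval ![x t, y t] (pderiv 0 P) + y' * eval ![x t, y t] (pderiv 1 P)) t := by
  induction P using MvPolynomial.induction_on with
  | C a => simpa using hasDerivAt_const t a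
  | add p q hp hq =>
    simp only [map_add]
    exact (hp.add hq).congr_deriv (by ring)
  | mul_X p i hp =>
    fin_cases i
    · simp only [map_mul, eval_X]
      exact (hp.mul hx).congr_deriv (by simp; ring)
    · simp only [map_mul, eval_X]
      exact (hp.mul hy).congr_deriv (by simp; ring)

/-- The exponent has derivative `a (z₁ - (b s + d)) + b (z₂ - (a s + c))`, a linear form in the
shifted arguments; these shifts themselves contribute `-b ∂₀ - a ∂₁`. The sum is `raise a b`. -/
theorem hasDerivAt_eval_mul_exp (P : MvPolynomial (Fin 2) ℂ) (z₁ z₂ a b c d t : ℂ) :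
    HasDerivAt (fun s => eval ![z₁ - (b * s + d), z₂ - (a * s + c)] P *
        Complex.exp ((a * s + c) * z₁ + (b * s + d) * z₂ - (a * s + c) * (b * s + d)))
      (eval ![z₁ - (b * t + d), z₂ - (a * t + c)] (raise a b P) *
        Complex.exp ((a * t + c) * z₁ + (b * t + d) * z₂ - (a * t + c) * (b * t + d))) t := by
  have h : ∀ a c : ℂ, HasDerivAt (fun s : ℂ => a * s + c) a t := fun a c => by
    simpa using ((hasDerivAt_id t).const_mul a).add_const c
  have hP := hasDerivAt_eval P ((h b d).const_sub z₁) ((h a c).const_sub z₂)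
  have hE := ((((h a c).mul_const z₁).add ((h b d).mul_const z₂)).sub
    ((h a c).mul (h b d))).cexp
  refine (hP.mul hE).congr_deriv ?_
  simp [raise]
  ring

theorem iteratedDeriv_eval_mul_exp (P : MvPolynomial (Fin 2) ℂ) (z₁ z₂ a b c d : ℂ) (n : ℕ) :
    iteratedDeriv n (fun s => eval ![z₁ - (b * s + d), z₂ - (a * s + c)] P *
        Complex.exp ((a * s + c) * z₁ + (b * s + d) * z₂ - (a * s + c) * (b * s + d))) =
      fun s => eval ![z₁ - (b * s + d), z₂ - (a * s + c)] ((raise a b)^[n] P) *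
        Complex.exp ((a * s + c) * z₁ + (b * s + d) * z₂ - (a * s + c) * (b * s + d)) := by
  induction n with
  | zero => simp
  | succ n ih =>
    rw [iteratedDeriv_succ, ih]
    funext t
    rw [(hasDerivAt_eval_mul_exp _ z₁ z₂ a b c d t).deriv, Function.iterate_succ_apply']

theorem deformedHermite_eq_eval (g : Matrix (Fin 2) (Fin 2) ℂ) (m n : ℕ) (z₁ z₂ : ℂ) :
    deformedHermite g m n z₁ z₂ = eval ![z₁, z₂] (hermitePoly g m n) := by
  -- The summands `+ 0` put the result in the form with `c = d = 0`, ready for the second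
  -- differentiation, in `u`.
  have h₁ : ∀ u : ℂ, iteratedDeriv n (fun v : ℂ => deformedGenFun g z₁ z₂ u v) 0 =
      eval ![z₁ - (g 1 0 * u + 0), z₂ - (g 0 0 * u + 0)] ((raise (g 0 1) (g 1 1))^[n] 1) *
        Complex.exp ((g 0 0 * u + 0) * z₁ + (g 1 0 * u + 0) * z₂ -
          (g 0 0 * u + 0) * (g 1 0 * u + 0)) := by
    intro u
    have := congrFun (iteratedDeriv_eval_mul_exp 1 z₁ z₂ (g 0 1) (g 1 1)
      (g 0 0 * u) (g 1 0 * u) n) 0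
    simp only [map_one, one_mul, mul_zero, zero_add] at this
    simp only [add_zero]
    rw [← this]
    simp only [deformedGenFun, add_comm]
  unfold deformedHermite
  simp_rw [h₁]
  rw [iteratedDeriv_eval_mul_exp]
  simp [hermitePoly]

/-! ### Complex conjugation -/

/-- Conjugation of the coefficients of a polynomial, together with the exchange of its variables. -/
noncomputable def conjSwap : MvPolynomial (Fin 2) ℂ →+* MvPolynomial (Fin 2) ℂ :=
  eval₂Hom (C.comp (starRingEnd ℂ)) ![X 1, X 0]

theorem conj_eval (P : MvPolynomial (Fin 2) ℂ) (z : ℂ) :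
    (starRingEnd ℂ) (eval ![z, (starRingEnd ℂ) z] P) =
      eval ![z, (starRingEnd ℂ) z] (conjSwap P) := by
  induction P using MvPolynomial.induction_on with
  | C a => simp [conjSwap]
  | add p q hp hq => simp [hp, hq]
  | mul_X p i hp => fin_cases i <;> simp [hp] <;> simp [conjSwap]

theorem pderiv_conjSwap (P : MvPolynomial (Fin 2) ℂ) :
    pderiv 0 (conjSwap P) = conjSwap (pderiv 1 P) ∧
      pderiv 1 (conjSwap P) = conjSwap (pderiv 0 P) := by
  have h0 : conjSwap (X 0) = X 1 := by simp [conjSwap]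
  have h1 : conjSwap (X 1) = X 0 := by simp [conjSwap]
  induction P using MvPolynomial.induction_on with
  | C a => simp [conjSwap]
  | add p q hp hq => simp [hp, hq]
  | mul_X p i hp => fin_cases i <;> simp [hp, h0, h1, pderiv_X]

theorem conjSwap_raise (a b : ℂ) (P : MvPolynomial (Fin 2) ℂ) :
    conjSwap (raise a b P) =
      raise ((starRingEnd ℂ) b) ((starRingEnd ℂ) a) (conjSwap P) := by
  have h0 : conjSwap (X 0) = X 1 := by simp [conjSwap]
  have h1 : conjSwap (X 1) = X 0 := by simp [conjSwap]
  have hC : ∀ c, conjSwap (C c) = C ((starRingEnd ℂ) c) := by simp [conjSwap]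
  simp [raise, h0, h1, hC, pderiv_conjSwap]
  ring

/-- Conjugation keeps the family stable: it conjugates the matrix and exchanges its rows (`1 - i` in
`Fin 2`). -/
theorem conjSwap_hermitePoly (h : Matrix (Fin 2) (Fin 2) ℂ) (p q : ℕ) :
    conjSwap (hermitePoly h p q) =
      hermitePoly (.of fun i j => (starRingEnd ℂ) (h (1 - i) j)) p q := by
  induction p with
  | zero =>
    induction q with
    | zero => rw [hermitePoly_zero_zero, hermitePoly_zero_zero, map_one]
    | succ q ih => rw [hermitePoly_zero_succ, hermitePoly_zero_succ, conjSwap_raise, ih]; rfl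
  | succ p ih => rw [hermitePoly_succ_left, hermitePoly_succ_left, conjSwap_raise, ih]; rfl

/-! ### Gaussian moments -/

theorem integrable_norm_pow_mul_exp (k : ℕ) :
    Integrable (fun z : ℂ => ‖z‖ ^ k * Real.exp (-‖z‖ ^ 2)) := by
  -- A non-integrable function has integral `0` by convention, while this integral is a positive
  -- Gamma value.
  refine not_imp_comm.1 integral_undef ?_
  have := Complex.integral_rpow_mul_exp_neg_rpow (p := 2) (q := k) one_le_two
    (by linarith [(Nat.cast_nonneg k : (0:ℝ) ≤ k)])
  simp only [Real.rpow_natCast, Real.rpow_two] at this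
  rw [this]
  have : 0 < Real.Gamma ((k + 2) / 2) := Real.Gamma_pos_of_pos (by positivity)
  positivity

theorem integrable_pow_mul_conj_pow_mul_exp (j k : ℕ) :
    Integrable (fun z : ℂ => z ^ j * (starRingEnd ℂ) z ^ k * (Real.exp (-‖z‖ ^ 2) : ℂ)) := by
  refine (integrable_norm_pow_mul_exp (j + k)).mono' (by fun_prop) (.of_forall fun z => ?_)
  rw [norm_mul, norm_mul, norm_pow, norm_pow, RCLike.norm_conj, Complex.norm_real,
    Real.norm_of_nonneg (Real.exp_pos _).le, pow_add]

theorem integral_pow_mul_conj_pow_mul_exp (j k : ℕ) :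
    ∫ z : ℂ, z ^ j * (starRingEnd ℂ) z ^ k * (Real.exp (-‖z‖ ^ 2) : ℂ) =
      if j = k then (Real.pi * j.factorial : ℂ) else 0 := by
  split_ifs with h
  · subst h
    have h1 : ∀ z : ℂ, z ^ j * (starRingEnd ℂ) z ^ j * (Real.exp (-‖z‖ ^ 2) : ℂ) =
        ((‖z‖ ^ (2 * j) * Real.exp (-‖z‖ ^ 2) : ℝ) : ℂ) := by
      intro z
      rw [← mul_pow, Complex.mul_conj']
      push_cast
      rw [pow_mul]
    simp_rw [h1]
    rw [integral_complex_ofReal]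
    have := Complex.integral_rpow_mul_exp_neg_rpow (p := 2) (q := (2 * j : ℕ)) one_le_two
      (by linarith [(Nat.cast_nonneg (2 * j) : (0:ℝ) ≤ (2 * j : ℕ))])
    simp only [Real.rpow_natCast, Real.rpow_two] at this
    rw [this, show (((2 * j : ℕ) : ℝ) + 2) / 2 = j + 1 by push_cast; ring,
      Real.Gamma_nat_eq_factorial]
    push_cast
    ring
  · set I := ∫ z : ℂ, z ^ j * (starRingEnd ℂ) z ^ k * (Real.exp (-‖z‖ ^ 2) : ℂ)
    -- Rotation invariance of the Gaussian measure.
    have hrot : ∀ c : Circle, (c : ℂ) ^ j * (starRingEnd ℂ) (c : ℂ) ^ k * I = I := by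
      intro c
      have := (rotation c).measurePreserving.integral_comp
        (rotation c).toHomeomorph.measurableEmbedding
        (fun z : ℂ => z ^ j * (starRingEnd ℂ) z ^ k * (Real.exp (-‖z‖ ^ 2) : ℂ))
      refine Eq.trans ?_ this
      rw [← integral_const_mul]
      congr 1
      funext z
      rw [LinearIsometryEquiv.norm_map, rotation_apply, map_mul, mul_pow, mul_pow]
      ring
    -- Rotation by one radian suffices: `exp (i (j - k)) = 1` with `j ≠ k` would make `π` rational.
    have h1 := hrot (Circle.exp 1)
    by_contra hI
    have h2 : ((Circle.exp 1 : Circle) : ℂ) ^ j * (starRingEnd ℂ) ((Circle.exp 1 : Circle) : ℂ) ^ k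
        = 1 := mul_right_cancel₀ hI (by rw [h1, one_mul])
    rw [Circle.coe_exp, ← Complex.exp_conj, ← Complex.exp_nat_mul, ← Complex.exp_nat_mul,
      ← Complex.exp_add, Complex.exp_eq_one_iff] at h2
    obtain ⟨n, hn⟩ := h2
    have h3 : (j : ℝ) - k = n * (2 * Real.pi) := by
      have := congrArg Complex.im hn
      simpa [sub_eq_add_neg] using this
    have hn0 : (n : ℝ) ≠ 0 := by
      rintro h0
      rw [h0, zero_mul, sub_eq_zero] at h3
      exact h (by exact_mod_cast h3)
    refine irrational_pi.ne_rat (((j : ℚ) - k) / (n * 2)) ?_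
    push_cast
    rw [h3]
    field_simp

theorem integrable_eval_mul_exp (P : MvPolynomial (Fin 2) ℂ) :
    Integrable (fun z : ℂ => eval ![z, (starRingEnd ℂ) z] P * (Real.exp (-‖z‖ ^ 2) : ℂ)) := by
  induction P using MvPolynomial.induction_on' with
  | monomial s a =>
    simpa [eval_monomial, Finsupp.prod_fintype, mul_assoc] using
      (integrable_pow_mul_conj_pow_mul_exp (s 0) (s 1)).const_mul a
  | add p q hp hq =>
    simp only [map_add, add_mul]
    exact hp.add hq

/-! ### Gaussian integration by parts -/

/-- Integration against the Gaussian weight of a polynomial evaluated at `(z, conj z)`. -/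
noncomputable def gaussianFunctional : MvPolynomial (Fin 2) ℂ →ₗ[ℂ] ℂ where
  toFun P := ∫ z : ℂ, eval ![z, (starRingEnd ℂ) z] P * (Real.exp (-‖z‖ ^ 2) : ℂ)
  map_add' P Q := by
    rw [← integral_add (integrable_eval_mul_exp P) (integrable_eval_mul_exp Q)]
    simp only [map_add, add_mul]
  map_smul' c P := by
    rw [RingHom.id_apply, smul_eq_mul, ← integral_const_mul]
    simp only [smul_eval, mul_assoc]

theorem gaussianFunctional_C_mul (c : ℂ) (P : MvPolynomial (Fin 2) ℂ) :
    gaussianFunctional (C c * P) = c * gaussianFunctional P := by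
  rw [← smul_eq_C_mul, map_smul, smul_eq_mul]

theorem gaussianFunctional_monomial (s : Fin 2 →₀ ℕ) (a : ℂ) :
    gaussianFunctional (monomial s a) =
      a * if s 0 = s 1 then (Real.pi * (s 0).factorial : ℂ) else 0 := by
  rw [← integral_pow_mul_conj_pow_mul_exp, ← integral_const_mul]
  simp [gaussianFunctional, eval_monomial, Finsupp.prod_fintype, mul_assoc]

theorem gaussianFunctional_one : gaussianFunctional 1 = Real.pi := by
  simpa using gaussianFunctional_monomial 0 1

/-- Integration by parts, obtained without boundary terms: on monomials it is the moment identity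
`(k + 1)! = (k + 1) k!`. -/
theorem gaussianFunctional_X_zero_mul (P : MvPolynomial (Fin 2) ℂ) :
    gaussianFunctional (X 0 * P) = gaussianFunctional (pderiv 1 P) := by
  induction P using MvPolynomial.induction_on' with
  | monomial s a =>
    rw [mul_comm, X, monomial_mul, pderiv_monomial, gaussianFunctional_monomial,
      gaussianFunctional_monomial]
    rcases h : s 1 with _ | k
    · simp [h]
    · by_cases h' : s 0 = k <;> simp [h, h', Nat.factorial_succ]
      ring
  | add p q hp hq => simp [mul_add, hp, hq]

theorem gaussianFunctional_X_one_mul (P : MvPolynomial (Fin 2) ℂ) :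
    gaussianFunctional (X 1 * P) = gaussianFunctional (pderiv 0 P) := by
  induction P using MvPolynomial.induction_on' with
  | monomial s a =>
    rw [mul_comm, X, monomial_mul, pderiv_monomial, gaussianFunctional_monomial,
      gaussianFunctional_monomial]
    rcases h : s 0 with _ | k
    · simp [h]
    · by_cases h' : k = s 1
      · simp [h, ← h', Nat.factorial_succ]
        ring
      · simp [h, h']
  | add p q hp hq => simp [mul_add, hp, hq]

/-- The adjoint of a raising operator for the Gaussian functional is a lowering derivation. -/
theorem gaussianFunctional_raise_mul (a b : ℂ) (P Q : MvPolynomial (Fin 2) ℂ) :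
    gaussianFunctional (raise a b P * Q) =
      a * gaussianFunctional (P * pderiv 1 Q) + b * gaussianFunctional (P * pderiv 0 Q) := by
  have h0 := gaussianFunctional_X_zero_mul (P * Q)
  have h1 := gaussianFunctional_X_one_mul (P * Q)
  rw [pderiv_mul, map_add] at h0 h1
  have : raise a b P * Q = C a * (X 0 * (P * Q) - pderiv 1 P * Q) +
      C b * (X 1 * (P * Q) - pderiv 0 P * Q) := by
    unfold raise; ring
  rw [this, map_add, gaussianFunctional_C_mul, gaussianFunctional_C_mul, map_sub, map_sub, h0, h1]
  ring

/-! ### Recurrences for the pairing -/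

/-- The pairing of two deformed Hermite polynomials in `L²` of the Gaussian weight. -/
noncomputable def hermitePairing (g h : Matrix (Fin 2) (Fin 2) ℂ) (m n p q : ℕ) : ℂ :=
  gaussianFunctional (hermitePoly g m n * conjSwap (hermitePoly h p q))

/-- The adjoint swaps `∂₀` and `∂₁`, and so does conjugation with the rows of `h`; the swaps cancel,
leaving column `j` of `h* g`. At `p = 0` or `q = 0` truncated subtraction is harmless, since its
coefficient vanishes. -/
theorem gaussianFunctional_raise_mul_conjSwap (g h : Matrix (Fin 2) (Fin 2) ℂ) (j : Fin 2)
    (P : MvPolynomial (Fin 2) ℂ) (p q : ℕ) :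
    gaussianFunctional (raise (g 0 j) (g 1 j) P * conjSwap (hermitePoly h p q)) =
      (h.conjTranspose * g) 0 j * p * gaussianFunctional (P * conjSwap (hermitePoly h (p - 1) q)) +
      (h.conjTranspose * g) 1 j * q *
        gaussianFunctional (P * conjSwap (hermitePoly h p (q - 1))) := by
  have e : ∀ (c d : ℂ) (A B : MvPolynomial (Fin 2) ℂ), P * (C c * A + C d * B) =
      C c * (P * A) + C d * (P * B) := fun c d A B => by ring
  simp only [gaussianFunctional_raise_mul, conjSwap_hermitePoly, pderiv_hermitePoly, e, map_add,
    gaussianFunctional_C_mul, Matrix.mul_apply, Fin.sum_univ_two, Matrix.conjTranspose_apply]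
  simp
  ring

theorem hermitePairing_succ_left (g h : Matrix (Fin 2) (Fin 2) ℂ) (m n p q : ℕ) :
    hermitePairing g h (m + 1) n p q =
      (h.conjTranspose * g) 0 0 * p * hermitePairing g h m n (p - 1) q +
      (h.conjTranspose * g) 1 0 * q * hermitePairing g h m n p (q - 1) := by
  rw [hermitePairing, hermitePoly_succ_left, gaussianFunctional_raise_mul_conjSwap]
  rfl

theorem hermitePairing_zero_succ (g h : Matrix (Fin 2) (Fin 2) ℂ) (n p q : ℕ) :
    hermitePairing g h 0 (n + 1) p q =
      (h.conjTranspose * g) 0 1 * p * hermitePairing g h 0 n (p - 1) q +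
      (h.conjTranspose * g) 1 1 * q * hermitePairing g h 0 n p (q - 1) := by
  rw [hermitePairing, hermitePoly_zero_succ, gaussianFunctional_raise_mul_conjSwap]
  rfl

theorem hermitePairing_zero_zero (g h : Matrix (Fin 2) (Fin 2) ℂ) (p q : ℕ) :
    hermitePairing g h 0 0 p q = if p = 0 ∧ q = 0 then (Real.pi : ℂ) else 0 := by
  rw [hermitePairing, hermitePoly_zero_zero, conjSwap_hermitePoly, one_mul]
  -- The adjoint derivation kills the constant `1`.
  have hr : ∀ a b P, gaussianFunctional (raise a b P) = 0 := fun a b P => by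
    simpa using gaussianFunctional_raise_mul a b P 1
  rcases p with _ | p
  · rcases q with _ | q
    · simp [hermitePoly_zero_zero, gaussianFunctional_one]
    · rw [hermitePoly_zero_succ, hr]; simp
  · rw [hermitePoly_succ_left, hr]; simp

theorem hermitePairing_of_diagonal {g h : Matrix (Fin 2) (Fin 2) ℂ} {l₁ l₂ : ℂ}
    (H : h.conjTranspose * g = !![l₁, 0; 0, l₂]) (m n p q : ℕ) :
    hermitePairing g h m n p q =
      (Real.pi : ℂ) * (m.factorial : ℂ) * (n.factorial : ℂ) * l₁ ^ m * l₂ ^ n *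
        (if m = p then 1 else 0) * (if n = q then 1 else 0) := by
  induction m generalizing p with
  | zero =>
    induction n generalizing q with
    | zero =>
      rw [hermitePairing_zero_zero]
      rcases p with _ | p <;> rcases q with _ | q <;> simp
    | succ n ih =>
      rw [hermitePairing_zero_succ, ih, H]
      rcases q with _ | q
      · simp
      · by_cases h1 : n = q <;> simp [h1, Nat.factorial_succ]
        ring_nf
  | succ m ih =>
    rw [hermitePairing_succ_left, ih, H]
    rcases p with _ | p
    · simp
    · by_cases h1 : m = p <;> simp [h1, Nat.factorial_succ]
      ring_nf

/-! ### Transfer to the plane and conclusion -/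

theorem hermiteIntegrand_eq (g h : Matrix (Fin 2) (Fin 2) ℂ) (m n p q : ℕ) :
    hermiteIntegrand g h m n p q =
      (fun z : ℂ => eval ![z, (starRingEnd ℂ) z]
        (hermitePoly g m n * conjSwap (hermitePoly h p q)) * (Real.exp (-‖z‖ ^ 2) : ℂ)) ∘
        Complex.measurableEquivRealProd.symm := by
  funext w
  have hz : Complex.measurableEquivRealProd.symm w = w.1 + w.2 * Complex.I := by
    rw [Complex.measurableEquivRealProd_symm_apply, Complex.mk_eq_add_mul_I]
  have hc : (w.1 - w.2 * Complex.I : ℂ) = (starRingEnd ℂ) (w.1 + w.2 * Complex.I) := by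
    simp [sub_eq_add_neg]
  have hn : -w.1 ^ 2 - w.2 ^ 2 = -‖(w.1 + w.2 * Complex.I : ℂ)‖ ^ 2 := by
    rw [← Complex.normSq_eq_norm_sq, Complex.normSq_add_mul_I]; ring
  rw [Function.comp_apply, hz, hermiteIntegrand, hc, hn, deformedHermite_eq_eval,
    deformedHermite_eq_eval, conj_eval, map_mul]

theorem integrable_hermiteIntegrand (g h : Matrix (Fin 2) (Fin 2) ℂ) (m n p q : ℕ) :
    Integrable (hermiteIntegrand g h m n p q) := by
  rw [hermiteIntegrand_eq]
  exact (Complex.volume_preserving_equiv_real_prod.symm).integrable_comp_of_integrable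
    (integrable_eval_mul_exp _)

theorem integral_hermiteIntegrand (g h : Matrix (Fin 2) (Fin 2) ℂ) (m n p q : ℕ) :
    ∫ w : ℝ × ℝ, hermiteIntegrand g h m n p q w = hermitePairing g h m n p q := by
  rw [hermiteIntegrand_eq]
  exact (Complex.volume_preserving_equiv_real_prod.symm).integral_comp
    Complex.measurableEquivRealProd.symm.measurableEmbedding
    (fun z : ℂ => eval ![z, (starRingEnd ℂ) z]
      (hermitePoly g m n * conjSwap (hermitePoly h p q)) * (Real.exp (-‖z‖ ^ 2) : ℂ))

theorem theorem2p2 (g h : Matrix (Fin 2) (Fin 2) ℂ) :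
    (∀ m n p q : ℕ,
      MeasureTheory.Integrable (hermiteIntegrand g h m n p q) MeasureTheory.volume) ∧
    ((∀ m n p q : ℕ, (m, n) ≠ (p, q) → ∫ w : ℝ × ℝ, hermiteIntegrand g h m n p q w = 0) ↔
      ∃ l₁ l₂ : ℂ, Matrix.conjTranspose h * g = !![l₁, 0; 0, l₂]) ∧
    (∀ l₁ l₂ : ℂ, Matrix.conjTranspose h * g = !![l₁, 0; 0, l₂] →
      ∀ m n p q : ℕ, ∫ w : ℝ × ℝ, hermiteIntegrand g h m n p q w =
        (Real.pi : ℂ) * (m.factorial : ℂ) * (n.factorial : ℂ) * l₁ ^ m * l₂ ^ n *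
          (if m = p then 1 else 0) * (if n = q then 1 else 0)) := by
  simp only [integral_hermiteIntegrand]
  refine ⟨integrable_hermiteIntegrand g h, ⟨fun H => ?_, ?_⟩,
    fun _ _ H => hermitePairing_of_diagonal H⟩
  -- These two relations say that `π` times each off-diagonal entry of `h* g` vanishes.
  · have h10 := H 1 0 0 1 (by simp)
    have h01 := H 0 1 1 0 (by simp)
    rw [hermitePairing_succ_left, hermitePairing_zero_zero, hermitePairing_zero_zero] at h10
    rw [hermitePairing_zero_succ, hermitePairing_zero_zero, hermitePairing_zero_zero] at h01
    refine ⟨(h.conjTranspose * g) 0 0, (h.conjTranspose * g) 1 1, ?_⟩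
    have e10 : (h.conjTranspose * g) 1 0 = 0 := by simpa [Real.pi_ne_zero] using h10
    have e01 : (h.conjTranspose * g) 0 1 = 0 := by simpa [Real.pi_ne_zero] using h01
    rw [Matrix.eta_fin_two (h.conjTranspose * g), e10, e01]
    simp
  · rintro ⟨l₁, l₂, H⟩ m n p q hne
    rw [hermitePairing_of_diagonal H]
    by_cases h1 : m = p
    · have h2 : n ≠ q := fun h2 => hne (by rw [h1, h2])
      simp [h2]
    · simp [h1]
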